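/- Let $d\in\mathbb N$, let $\Omega\subset\mathbb R^d$ be a bounded open set (in particular, a bounded Lipschitz domain is allowed), and let $T>0$. Write $(\cdot,\cdot)$ for the inner products of $L^2(\Omega)$ and $L^2(\Omega;\mathbb R^d)$, and let $H^1_0(\Omega)$ be the closure of $C_c^\infty(\Omega)$ in $H^1(\Omega)$. Assume: 1. $\rho\in C^1([0,T];L^\infty(\Omega))$ and there are constants with $0<\rho_0\le\rho(t,x)\le\rho_1<\infty$ and $|\partial_t\rho(t,x)|\le\rho_1'<\infty$ for all $t\in[0,T]$ and a.e. $x\in\Omega$; 2. $\eta\in C([0,T];L^\infty(\Omega))$ and there are constants with $0<\eta_0\le\eta(t,x)\le\eta_1<\infty$ for all $t\in[0,T]$ and a.e. $x\in\Omega$; 3. $\kappa\in C^1([0,T];L^\infty(\Omega))$ and there are constants with $0<\kappa_0\le\kappa(t,x)\le\kappa_1<\infty$ and $|\partial_t\kappa(t,x)|\le\kappa_1'<\infty$ for all $t\in[0,T]$ and a.e. $x\in\Omega$; 4. $f:\mathbb R\to\mathbb R$ is Lipschitz continuous; 5. $F\in L^2(0,T;L^2(\Omega))$; 6. $\tilde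 u_0\in H^1_0(\Omega)$. Then there is at most one function $u\in C([0,T];H^1_0(\Omega))$ with weak time derivative $\partial_t u\in L^2(0,T;H^1_0(\Omega))$ such that $u(0)=\tilde u_0$ a.e. in $\Omega$ and, for almost every $t\in(0,T)$ and every $\varphi\in H^1_0(\Omega)$, $$(\partial_t(\rho(t)u(t)),\varphi)+(\eta(t)\nabla\partial_t u(t),\nabla\varphi)+(\kappa(t)\nabla u(t),\nabla\varphi)=(f(u(t)),\varphi)+(F(t),\varphi),$$ where $\partial_t(\rho u)$ is the weak time derivative of the $L^2(\Omega)$-valued function $t\mapsto\rho(t)u(t)$. That is, any two such functions $u_1,u_2$ satisfy $u_1(t)=u_2(t)$ in $H^1_0(\Omega)$ for all $t\in[0,T]$. -/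

import Mathlib

open MeasureTheory Set Filter
open scoped ENNReal NNReal ContDiff Gradient InnerProductSpace

namespace PseudoParabolic

/-- Euclidean space `ℝᵈ`. -/
abbrev E (d : ℕ) : Type := EuclideanSpace ℝ (Fin d)

/-- Lebesgue measure on `Ω`. -/
noncomputable abbrev volOn {d : ℕ} (Ω : Set (E d)) : Measure (E d) := volume.restrict Ω

/-- `L²(Ω)`. -/
abbrev L2 {d : ℕ} (Ω : Set (E d)) : Type := Lp ℝ 2 (volOn Ω)

/-- `L²(Ω; ℝᵈ)`. -/
abbrev L2vec {d : ℕ} (Ω : Set (E d)) : Type := Lp (E d) 2 (volOn Ω)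

/-- `L^∞(Ω)`. -/
abbrev Linf {d : ℕ} (Ω : Set (E d)) : Type := Lp ℝ ∞ (volOn Ω)

/-- The Hilbert space `L²(Ω) × L²(Ω; ℝᵈ)` with norm `(‖v‖² + ‖g‖²)^{1/2}`; on pairs `(v, ∇v)`
this is the norm of `H¹(Ω)`. -/
abbrev GraphSpace {d : ℕ} (Ω : Set (E d)) : Type := WithLp 2 (L2 Ω × L2vec Ω)

/-- The pairs `(φ, ∇φ)` with `φ ∈ C_c^∞(Ω)`. -/
def testGraph {d : ℕ} (Ω : Set (E d)) : Set (GraphSpace Ω) :=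
  {p | ∃ φ : E d → ℝ, ContDiff ℝ ∞ φ ∧ HasCompactSupport φ ∧ tsupport φ ⊆ Ω ∧
    p.fst =ᵐ[volOn Ω] φ ∧ p.snd =ᵐ[volOn Ω] ∇ φ}

/-- `H¹₀(Ω)`, the closure of `C_c^∞(Ω)` in the norm of `H¹(Ω)`. A function `v` of `H¹₀(Ω)` is
recorded as the pair `(v, ∇v)`; the second component is determined by the first, see
`H10.weak_gradient` and `H10.fn_injective`. -/
noncomputable abbrev H10 {d : ℕ} (Ω : Set (E d)) : Submodule ℝ (GraphSpace Ω) :=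
  (Submodule.span ℝ (testGraph Ω)).topologicalClosure

namespace H10

/-- The function underlying an element of `H¹₀(Ω)`. -/
noncomputable def fn {d : ℕ} {Ω : Set (E d)} (v : H10 Ω) : L2 Ω := (v : GraphSpace Ω).fst

/-- The gradient of an element of `H¹₀(Ω)`. -/
noncomputable def grad {d : ℕ} {Ω : Set (E d)} (v : H10 Ω) : L2vec Ω := (v : GraphSpace Ω).snd

/-- The second component of an element of `H¹₀(Ω)` is the weak gradient of the first. -/
theorem weak_gradient {d : ℕ} {Ω : Set (E d)} (v : H10 Ω) (ψ : E d → ℝ)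
    (hψ : ContDiff ℝ ∞ ψ) (hc : HasCompactSupport ψ) (hs : tsupport ψ ⊆ Ω) (e : E d) :
    ∫ x in Ω, fn v x * fderiv ℝ ψ x e = - ∫ x in Ω, ⟪grad v x, e⟫_ℝ * ψ x := by
  have hdc : Continuous (fun x => fderiv ℝ ψ x e) :=
    (hψ.continuous_fderiv (by simp)).clm_apply continuous_const
  have hdcs : HasCompactSupport (fun x => fderiv ℝ ψ x e) := hc.fderiv_apply (𝕜 := ℝ) e
  have hAm : MemLp (fun x => fderiv ℝ ψ x e) 2 (volOn Ω) :=
    (hdc.memLp_of_hasCompactSupport hdcs).restrict Ω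
  have hBm : MemLp (fun x => ψ x • e) 2 (volOn Ω) :=
    ((hψ.continuous.smul continuous_const).memLp_of_hasCompactSupport hc.smul_right).restrict Ω
  have hA : ∀ p : L2 Ω, ⟪hAm.toLp, p⟫_ℝ = ∫ x in Ω, p x * fderiv ℝ ψ x e := by
    intro p
    rw [L2.inner_def]
    refine integral_congr_ae ?_
    filter_upwards [hAm.coeFn_toLp] with x hx
    rw [hx]; simp
  have hB : ∀ p : L2vec Ω, ⟪hBm.toLp, p⟫_ℝ = ∫ x in Ω, ⟪p x, e⟫_ℝ * ψ x := by
    intro p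
    rw [L2.inner_def]
    refine integral_congr_ae ?_
    filter_upwards [hBm.coeFn_toLp] with x hx
    rw [hx, real_inner_smul_left, real_inner_comm, mul_comm]
  let q : GraphSpace Ω := WithLp.toLp 2 (hAm.toLp, hBm.toLp)
  have key : H10 Ω ≤ LinearMap.ker (innerSL ℝ q).toLinearMap := by
    refine Submodule.topologicalClosure_minimal _ (Submodule.span_le.2 ?_)
      (innerSL ℝ q).isClosed_ker
    rintro p ⟨φ, hφ, hφc, hφs, h1, h2⟩
    change ⟪q, p⟫_ℝ = 0
    rw [WithLp.prod_inner_apply]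
    change ⟪hAm.toLp, p.fst⟫_ℝ + ⟪hBm.toLp, p.snd⟫_ℝ = 0
    rw [hA, hB]
    have i1 : ∫ x in Ω, p.fst x * fderiv ℝ ψ x e = ∫ x, φ x * fderiv ℝ ψ x e := by
      rw [← setIntegral_eq_integral_of_forall_compl_eq_zero (s := Ω)
        (f := fun x => φ x * fderiv ℝ ψ x e)]
      · refine integral_congr_ae ?_
        filter_upwards [h1] with x hx
        rw [hx]
      · intro x hx
        rw [image_eq_zero_of_notMem_tsupport (fun h => hx (hφs h)), zero_mul]
    have i2 : ∫ x in Ω, ⟪p.snd x, e⟫_ℝ * ψ x = ∫ x, fderiv ℝ φ x e * ψ x := by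
      rw [← setIntegral_eq_integral_of_forall_compl_eq_zero (s := Ω)
        (f := fun x => fderiv ℝ φ x e * ψ x)]
      · refine integral_congr_ae ?_
        filter_upwards [h2] with x hx
        rw [hx, gradient, InnerProductSpace.toDual_symm_apply]
      · intro x hx
        rw [image_eq_zero_of_notMem_tsupport (fun h => hx (hs h)), mul_zero]
    have hdφ : Continuous (fun x => fderiv ℝ φ x e) :=
      (hφ.continuous_fderiv (by simp)).clm_apply continuous_const
    rw [i1, i2, integral_mul_fderiv_eq_neg_fderiv_mul_of_integrable]
    · simp
    · exact (hdφ.mul hψ.continuous).integrable_of_hasCompactSupport hc.mul_left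
    · exact (hφ.continuous.mul hdc).integrable_of_hasCompactSupport hφc.mul_right
    · exact (hφ.continuous.mul hψ.continuous).integrable_of_hasCompactSupport hφc.mul_right
    · exact fun x _ => hφ.differentiable (by simp) x
    · exact fun x _ => hψ.differentiable (by simp) x
  have h : ⟪q, (v : GraphSpace Ω)⟫_ℝ = 0 := key v.2
  rw [WithLp.prod_inner_apply] at h
  change ⟪hAm.toLp, fn v⟫_ℝ + ⟪hBm.toLp, grad v⟫_ℝ = 0 at h
  rw [hA, hB] at h
  linarith

/-- An element of `H¹₀(Ω)` is determined by its underlying function. -/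
theorem fn_injective {d : ℕ} {Ω : Set (E d)} (hΩ : IsOpen Ω) :
    Function.Injective (fn : H10 Ω → L2 Ω) := by
  intro v w hvw
  have h0 : fn (v - w) = 0 := by
    change (v : GraphSpace Ω).fst - (w : GraphSpace Ω).fst = 0
    exact sub_eq_zero.2 hvw
  have hg : ∀ e : E d, ∀ᵐ x ∂(volOn Ω), ⟪grad (v - w) x, e⟫_ℝ = 0 := by
    intro e
    rw [ae_restrict_iff' hΩ.measurableSet]
    refine hΩ.ae_eq_zero_of_integral_contDiff_smul_eq_zero ?_ ?_
    · have hm : MemLp (fun x => ⟪grad (v - w) x, e⟫_ℝ) 2 (volOn Ω) :=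
        (Lp.memLp (grad (v - w))).inner_const e
      rw [locallyIntegrableOn_iff hΩ.isLocallyClosed]
      intro K hK hKc
      have : IsFiniteMeasure (volume.restrict K) := ⟨by simpa using hKc.measure_lt_top⟩
      exact (hm.mono_measure (Measure.restrict_mono_set _ hK)).integrable (by norm_num)
    · intro ψ hψ hc hs
      have hw := weak_gradient (v - w) ψ hψ hc hs e
      have hz : ∫ x in Ω, fn (v - w) x * fderiv ℝ ψ x e = 0 := by
        rw [h0]
        refine integral_eq_zero_of_ae ?_
        filter_upwards [Lp.coeFn_zero ℝ 2 (volOn Ω)] with x hx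
        rw [hx]; simp
      rw [← setIntegral_eq_integral_of_forall_compl_eq_zero (s := Ω)]
      · simp only [smul_eq_mul, mul_comm (ψ _)]
        linarith
      · intro x hx
        rw [image_eq_zero_of_notMem_tsupport (fun h => hx (hs h)), zero_smul]
  have hg0 : grad (v - w) = 0 := by
    refine Lp.ext ?_
    have hall : ∀ᵐ x ∂(volOn Ω), ∀ i : Fin d,
        ⟪grad (v - w) x, EuclideanSpace.single i (1 : ℝ)⟫_ℝ = 0 :=
      ae_all_iff.2 fun i => hg _
    filter_upwards [hall, Lp.coeFn_zero (E d) 2 (volOn Ω)] with x hx hx0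
    rw [hx0]
    ext i
    simpa [EuclideanSpace.inner_single_right] using hx i
  refine Subtype.ext ((WithLp.ofLp_injective 2) (Prod.ext hvw ?_))
  exact sub_eq_zero.1 hg0

end H10

/-- `w` is the weak (distributional) derivative of `u : (0,T) → X`: both are locally Bochner
integrable on `(0,T)` and `∫₀ᵀ ψ' u dt = - ∫₀ᵀ ψ w dt` for all `ψ ∈ C_c^∞(0,T)`. -/
def HasWeakTimeDeriv {X : Type*} [NormedAddCommGroup X] [NormedSpace ℝ X] (T : ℝ)
    (u w : ℝ → X) : Prop :=
  LocallyIntegrableOn u (Ioo 0 T) ∧ LocallyIntegrableOn w (Ioo 0 T) ∧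
  ∀ ψ : ℝ → ℝ, ContDiff ℝ ∞ ψ → HasCompactSupport ψ → tsupport ψ ⊆ Ioo 0 T →
    ∫ t in Ioo 0 T, deriv ψ t • u t = - ∫ t in Ioo 0 T, ψ t • w t

/-- `u` is a solution of the variational direct problem with `u ∈ C([0,T]; H¹₀(Ω))` and
`∂ₜu ∈ L²(0,T; H¹₀(Ω))`. Here `u'` is `∂ₜu` and `z` is `∂ₜ(ρu)`, the latter as the weak time
derivative of the `L²(Ω)`-valued function `t ↦ ρ(t)u(t)`; `⟪·,·⟫_ℝ` is the inner product of
`L²(Ω)` or of `L²(Ω; ℝᵈ)`. -/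
def IsSolution {d : ℕ} (Ω : Set (E d)) (T : ℝ) (ρ η κ : ℝ → Linf Ω) (f : ℝ → ℝ)
    (F : ℝ → L2 Ω) (u₀ : H10 Ω) (u : ℝ → H10 Ω) : Prop :=
  ContinuousOn u (Icc 0 T) ∧
  H10.fn (u 0) =ᵐ[volOn Ω] H10.fn u₀ ∧
  ∃ u' : ℝ → H10 Ω, HasWeakTimeDeriv T u u' ∧ MemLp u' 2 (volume.restrict (Ioo 0 T)) ∧
  ∃ z : ℝ → L2 Ω, HasWeakTimeDeriv T (fun t => (ρ t • H10.fn (u t) : L2 Ω)) z ∧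
  ∀ᵐ t ∂(volume.restrict (Ioo 0 T)), ∀ φ : H10 Ω,
    ⟪z t, H10.fn φ⟫_ℝ + ⟪(η t • H10.grad (u' t) : L2vec Ω), H10.grad φ⟫_ℝ
        + ⟪(κ t • H10.grad (u t) : L2vec Ω), H10.grad φ⟫_ℝ
      = (∫ x in Ω, f (H10.fn (u t) x) * H10.fn φ x) + ⟪F t, H10.fn φ⟫_ℝ

end PseudoParabolic

open PseudoParabolic

/-! Let `q` be the difference of two solutions and `p` its weak time derivative. As ρ is C¹ in time,
the product rule gives ∂ₜ(ρu) = ρ∂ₜu + (∂ₜρ)u almost everywhere (`ae_weakTimeDeriv_mul_eq`).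
Subtract the two equations, so that F cancels, and test with `p` itself, which is admissible because
it takes values in H¹₀. The lower bounds on ρ and η make the terms quadratic in `p` coercive on H¹₀,
while the terms with ∂ₜρ, κ and f are at most a constant times ‖q‖‖p‖. Hence ‖p‖ ≤ C‖q‖ for almost
every t (`norm_le_of_energy_identity`): the problem behaves like an ODE in H¹₀ with a Lipschitz
right-hand side, and Grönwall with q(0) = 0 gives q = 0 (`eq_zero_of_norm_weakTimeDeriv_le`).

The analytic work lies in the distributional derivative. A continuous function is shown to be a
primitive of its weak derivative (`HasWeakTimeDeriv.sub_eq_integral`), hence to have it as classical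
derivative almost everywhere (`HasWeakTimeDeriv.ae_hasDerivAt`). The first fact feeds Grönwall, the
second the product rule. -/

namespace PseudoParabolic

/-! ### Weak time derivatives of continuous Banach-valued functions. -/

section WeakTimeDerivative

open Topology Real

/-- The derivative of the smooth transition function vanishes outside `[0, 1]`. -/
theorem deriv_smoothTransition_eq_zero {x : ℝ} (hx : x ∉ Icc (0 : ℝ) 1) :
    deriv smoothTransition x = 0 := by
  rcases not_and_or.1 hx with h | h
  · have : smoothTransition =ᶠ[𝓝 x] fun _ => (0 : ℝ) := by
      filter_upwards [Iio_mem_nhds (not_le.1 h)] with y hy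
      exact smoothTransition.zero_of_nonpos (le_of_lt hy)
    rw [this.deriv_eq, deriv_const]
  · have : smoothTransition =ᶠ[𝓝 x] fun _ => (1 : ℝ) := by
      filter_upwards [Ioi_mem_nhds (not_le.1 h)] with y hy
      exact smoothTransition.one_of_one_le (le_of_lt hy)
    rw [this.deriv_eq, deriv_const]

theorem hasCompactSupport_deriv_smoothTransition :
    HasCompactSupport (deriv smoothTransition) :=
  HasCompactSupport.intro isCompact_Icc fun _ hx => deriv_smoothTransition_eq_zero hx

theorem continuous_deriv_smoothTransition : Continuous (deriv smoothTransition) :=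
  (smoothTransition.contDiff (n := 1)).continuous_deriv (by simp)

theorem integrable_deriv_smoothTransition : Integrable (deriv smoothTransition) :=
  continuous_deriv_smoothTransition.integrable_of_hasCompactSupport
    hasCompactSupport_deriv_smoothTransition

theorem hasDerivAt_smoothTransition (x : ℝ) :
    HasDerivAt smoothTransition (deriv smoothTransition x) x :=
  ((smoothTransition.contDiff (n := 1)).differentiable (by simp) x).hasDerivAt

theorem integral_deriv_smoothTransition : ∫ x, deriv smoothTransition x = 1 := by
  have hb : Tendsto smoothTransition atBot (𝓝 0) := by
    refine tendsto_const_nhds.congr' ?_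
    filter_upwards [eventually_le_atBot 0] with x hx
    exact (smoothTransition.zero_of_nonpos hx).symm
  have ht : Tendsto smoothTransition atTop (𝓝 1) := by
    refine tendsto_const_nhds.congr' ?_
    filter_upwards [eventually_ge_atTop 1] with x hx
    exact (smoothTransition.one_of_one_le hx).symm
  rw [integral_of_hasDerivAt_of_tendsto hasDerivAt_smoothTransition
    integrable_deriv_smoothTransition hb ht, sub_zero]

variable {X : Type*} [NormedAddCommGroup X] [NormedSpace ℝ X]

/-- The rescaled derivatives of the smooth transition function form an approximate identity. -/
theorem tendsto_integral_deriv_smoothTransition_smul [CompleteSpace X] {V : ℝ → X}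
    (hV : Continuous V) {C : ℝ} (hC : ∀ x, ‖V x‖ ≤ C) (a : ℝ) :
    Tendsto (fun n : ℕ => ∫ s, ((n + 1 : ℝ) * deriv smoothTransition ((n + 1 : ℝ) * (s - a))) • V s)
      atTop (𝓝 (V a)) := by
  -- Substitute r = (n+1)(s - a), which moves the concentration from the kernel into the argument of
  -- `V`.
  have hsub : ∀ n : ℕ,
      ∫ s, ((n + 1 : ℝ) * deriv smoothTransition ((n + 1 : ℝ) * (s - a))) • V s
        = ∫ r, deriv smoothTransition r • V (a + (n + 1 : ℝ)⁻¹ * r) := by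
    intro n
    have hn : (0 : ℝ) < n + 1 := by positivity
    rw [← integral_add_right_eq_self (μ := volume) _ a]
    have h := Measure.integral_comp_mul_left
      (fun r => deriv smoothTransition r • V (a + (n + 1 : ℝ)⁻¹ * r)) (n + 1 : ℝ)
    rw [abs_of_pos (inv_pos.2 hn), eq_inv_smul_iff₀ hn.ne'] at h
    rw [← h, ← integral_smul]
    refine integral_congr_ae (.of_forall fun s => ?_)
    simp only [add_sub_cancel_right, inv_mul_cancel_left₀ hn.ne', mul_smul, add_comm a s]
  simp_rw [hsub]
  have hlim : V a = ∫ r, deriv smoothTransition r • V a := by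
    rw [integral_smul_const, integral_deriv_smoothTransition, one_smul]
  rw [hlim]
  refine tendsto_integral_of_dominated_convergence
    (fun r => ‖deriv smoothTransition r‖ * C) ?_ ?_ ?_ ?_
  · intro n
    exact (continuous_deriv_smoothTransition.smul
      (hV.comp (by fun_prop))).aestronglyMeasurable
  · exact integrable_deriv_smoothTransition.norm.mul_const C
  · intro n
    refine .of_forall fun r => ?_
    rw [norm_smul]
    gcongr
    exact hC _
  · refine .of_forall fun r => ?_
    refine tendsto_const_nhds.smul ((hV.tendsto a).comp ?_)
    have : Tendsto (fun n : ℕ => (n + 1 : ℝ)⁻¹) atTop (𝓝 0) := by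
      simpa using tendsto_one_div_add_atTop_nhds_zero_nat (𝕜 := ℝ)
    simpa using (this.mul_const r).const_add a

/-- A continuous function is a primitive of its weak derivative. -/
theorem HasWeakTimeDeriv.sub_eq_integral [CompleteSpace X] {T : ℝ} {v w : ℝ → X}
    (h : HasWeakTimeDeriv T v w) (hv : ContinuousOn v (Ioo 0 T)) {a b : ℝ}
    (ha : 0 < a) (hab : a ≤ b) (hb : b < T) :
    v b - v a = ∫ s in a..b, w s := by
  -- The gap between `b` and `c` leaves room for the falling edge of the test functions.
  obtain ⟨c, hbc, hcT⟩ := exists_between hb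
  have hac : a ≤ c := hab.trans hbc.le
  have hsub : Icc a c ⊆ Ioo 0 T := fun x hx => ⟨ha.trans_le hx.1, hx.2.trans_lt hcT⟩
  have hwi : IntegrableOn w (Icc a c) :=
    h.2.1.integrableOn_compact_subset hsub isCompact_Icc
  -- extend `v` from `[a, c]` to a bounded continuous function on the line
  let V : ℝ → X := IccExtend hac ((Icc a c).domRestrict v)
  have hV : Continuous V := (hv.mono hsub).domRestrict.Icc_extend'
  have hVv : ∀ x ∈ Icc a c, V x = v x := fun x hx => by
    simp only [V, IccExtend_of_mem hac _ hx, domRestrict_apply]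
  obtain ⟨C, hC⟩ := isCompact_Icc.exists_bound_of_continuousOn (hv.mono hsub)
  have hVC : ∀ x, ‖V x‖ ≤ C := fun x => hC _ (projIcc a c hac x).2
  -- Smooth cutoffs rising on [a, a + 1/(n+1)] and falling on [b, b + 1/(n+1)] for large n. Both
  -- edges lie to the right of the endpoints, so the pointwise limit is the indicator of (a, b].
  let ψ : ℕ → ℝ → ℝ := fun n s =>
    smoothTransition ((n + 1 : ℝ) * (s - a)) - smoothTransition ((n + 1 : ℝ) * (s - b))
  have hψd : ∀ n s, HasDerivAt (ψ n)
      ((n + 1 : ℝ) * deriv smoothTransition ((n + 1 : ℝ) * (s - a))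
        - (n + 1 : ℝ) * deriv smoothTransition ((n + 1 : ℝ) * (s - b))) s := by
    intro n s
    have hl : ∀ e : ℝ, HasDerivAt (fun s : ℝ => (n + 1 : ℝ) * (s - e)) (n + 1 : ℝ) s := fun e => by
      simpa using ((hasDerivAt_id s).sub_const e).const_mul (n + 1 : ℝ)
    have h1 := (hasDerivAt_smoothTransition _).comp s (hl a)
    have h2 := (hasDerivAt_smoothTransition _).comp s (hl b)
    rw [mul_comm (n + 1 : ℝ), mul_comm (n + 1 : ℝ) (deriv smoothTransition _)]
    exact h1.sub h2
  have hψs : ∀ n, ContDiff ℝ ∞ (ψ n) := fun n =>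
    (smoothTransition.contDiff.comp (by fun_prop)).sub
      (smoothTransition.contDiff.comp (by fun_prop))
  have hψ1 : ∀ n s, ‖ψ n s‖ ≤ 1 := by
    intro n s
    rw [Real.norm_eq_abs, abs_le]
    constructor <;>
    linarith [smoothTransition.nonneg ((n + 1 : ℝ) * (s - a)),
      smoothTransition.le_one ((n + 1 : ℝ) * (s - a)),
      smoothTransition.nonneg ((n + 1 : ℝ) * (s - b)),
      smoothTransition.le_one ((n + 1 : ℝ) * (s - b))]
  have hlarge : ∀ e : ℝ, 0 < e → ∀ᶠ n : ℕ in atTop, 1 ≤ (n + 1 : ℝ) * e := by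
    intro e he
    have := (tendsto_atTop_add_const_right atTop (1 : ℝ)
      (tendsto_natCast_atTop_atTop (R := ℝ))).atTop_mul_const he
    exact this.eventually_ge_atTop 1
  have hψ0 : ∀ᶠ n in atTop, ∀ s ∉ Icc a c, ψ n s = 0 := by
    filter_upwards [hlarge (c - b) (sub_pos.2 hbc)] with n hn s hs
    have hn1 : (0 : ℝ) < n + 1 := by positivity
    rcases not_and_or.1 hs with hs | hs
    · have h1 : (n + 1 : ℝ) * (s - a) ≤ 0 :=
        mul_nonpos_of_nonneg_of_nonpos hn1.le (by linarith [not_le.1 hs])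
      have h2 : (n + 1 : ℝ) * (s - b) ≤ 0 :=
        mul_nonpos_of_nonneg_of_nonpos hn1.le (by linarith [not_le.1 hs])
      simp only [ψ, smoothTransition.zero_of_nonpos h1, smoothTransition.zero_of_nonpos h2,
        sub_zero]
    · have h2 : 1 ≤ (n + 1 : ℝ) * (s - b) :=
        hn.trans (by gcongr; exact (not_le.1 hs).le)
      have h1 : 1 ≤ (n + 1 : ℝ) * (s - a) := h2.trans (by gcongr)
      simp only [ψ, smoothTransition.one_of_one_le h1, smoothTransition.one_of_one_le h2,
        sub_self]
  -- The weak identity tested with `ψ n`: its derivative is the difference of two approximate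
  -- identities, at `a` and at `b`, so the left side tends to V a - V b.
  have hweak : ∀ᶠ n : ℕ in atTop,
      (∫ s, ((n + 1 : ℝ) * deriv smoothTransition ((n + 1 : ℝ) * (s - a))) • V s)
        - (∫ s, ((n + 1 : ℝ) * deriv smoothTransition ((n + 1 : ℝ) * (s - b))) • V s)
        = - ∫ s in Icc a c, ψ n s • w s := by
    filter_upwards [hψ0] with n hn
    have hts : tsupport (ψ n) ⊆ Icc a c :=
      closure_minimal (fun s hs => by_contra fun hs' => hs (hn s hs')) isClosed_Icc
    have hcs : HasCompactSupport (ψ n) := isCompact_Icc.of_isClosed_subset (isClosed_tsupport _) hts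
    have hint : ∀ e : ℝ, Integrable
        (fun s => ((n + 1 : ℝ) * deriv smoothTransition ((n + 1 : ℝ) * (s - e))) • V s) := by
      intro e
      have hn1 : (n + 1 : ℝ) ≠ 0 := by positivity
      have h1 : Integrable (fun s => deriv smoothTransition ((n + 1 : ℝ) * (s - e))) :=
        (integrable_deriv_smoothTransition.comp_mul_left' hn1).comp_sub_right e
      exact (h1.const_mul _).smul_bdd C hV.aestronglyMeasurable (.of_forall hVC)
    have hw := h.2.2 (ψ n) (hψs n) hcs (hts.trans hsub)
    have hd0 : ∀ s ∉ Icc a c, deriv (ψ n) s = 0 := fun s hs =>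
      image_eq_zero_of_notMem_tsupport fun h' => hs (hts (tsupport_deriv_subset h'))
    have hl : ∫ s in Ioo 0 T, deriv (ψ n) s • v s = ∫ s, deriv (ψ n) s • V s := by
      rw [← setIntegral_eq_integral_of_forall_compl_eq_zero (s := Ioo 0 T)
        (f := fun s => deriv (ψ n) s • V s)]
      · refine setIntegral_congr_fun measurableSet_Ioo fun s _ => ?_
        by_cases hs : s ∈ Icc a c
        · simp only [hVv s hs]
        · simp only [hd0 s hs, zero_smul]
      · intro s hs
        rw [hd0 s fun h' => hs (hsub h'), zero_smul]
    have hr : ∫ s in Ioo 0 T, ψ n s • w s = ∫ s in Icc a c, ψ n s • w s := by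
      refine setIntegral_eq_of_subset_of_forall_sdiff_eq_zero measurableSet_Ioo hsub ?_
      intro s hs
      rw [hn s hs.2, zero_smul]
    rw [← hr, ← hw, hl, ← integral_sub (hint a) (hint b)]
    refine integral_congr_ae (.of_forall fun s => ?_)
    simp only [(hψd n s).deriv, sub_smul]
  have hlimw : Tendsto (fun n => ∫ s in Icc a c, ψ n s • w s) atTop
      (𝓝 (∫ s in Icc a c, (Ioc a b).indicator w s)) := by
    refine tendsto_integral_of_dominated_convergence (fun s => ‖w s‖) ?_ hwi.norm ?_ ?_
    · intro n
      exact (hψs n).continuous.aestronglyMeasurable.smul hwi.aestronglyMeasurable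
    · intro n
      refine .of_forall fun s => ?_
      rw [norm_smul]
      exact mul_le_of_le_one_left (norm_nonneg _) (hψ1 n s)
    · refine .of_forall fun s => ?_
      refine tendsto_const_nhds.congr' ?_
      rcases le_or_gt s a with hsa | hsa
      · refine .of_forall fun n => ?_
        have hn1 : (0 : ℝ) < n + 1 := by positivity
        have h1 : (n + 1 : ℝ) * (s - a) ≤ 0 :=
          mul_nonpos_of_nonneg_of_nonpos hn1.le (by linarith)
        have h2 : (n + 1 : ℝ) * (s - b) ≤ 0 :=
          mul_nonpos_of_nonneg_of_nonpos hn1.le (by linarith)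
        rw [indicator_of_notMem (fun h' => h'.1.not_ge hsa)]
        simp only [ψ, smoothTransition.zero_of_nonpos h1, smoothTransition.zero_of_nonpos h2,
          sub_zero, zero_smul]
      · rcases le_or_gt s b with hsb | hsb
        · filter_upwards [hlarge (s - a) (sub_pos.2 hsa)] with n hn
          have hn1 : (0 : ℝ) < n + 1 := by positivity
          have h2 : (n + 1 : ℝ) * (s - b) ≤ 0 :=
            mul_nonpos_of_nonneg_of_nonpos hn1.le (by linarith)
          rw [indicator_of_mem (show s ∈ Ioc a b from ⟨hsa, hsb⟩)]
          simp only [ψ, smoothTransition.one_of_one_le hn, smoothTransition.zero_of_nonpos h2,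
            sub_zero, one_smul]
        · filter_upwards [hlarge (s - a) (sub_pos.2 hsa), hlarge (s - b) (sub_pos.2 hsb)]
            with n hn hn'
          rw [indicator_of_notMem (fun h' => h'.2.not_gt hsb)]
          simp only [ψ, smoothTransition.one_of_one_le hn, smoothTransition.one_of_one_le hn',
            sub_self, zero_smul]
  have hlimv := (tendsto_integral_deriv_smoothTransition_smul hV hVC a).sub
    (tendsto_integral_deriv_smoothTransition_smul hV hVC b)
  have heq := tendsto_nhds_unique (hlimv.congr' hweak) hlimw.neg
  rw [hVv a ⟨le_rfl, hac⟩, hVv b ⟨hab, hbc.le⟩, setIntegral_indicator measurableSet_Ioc,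
    inter_eq_right.2 (show Ioc a b ⊆ Icc a c from fun x hx => ⟨hx.1.le, hx.2.trans hbc.le⟩)] at heq
  rw [intervalIntegral.integral_of_le hab, ← neg_sub, heq, neg_neg]

/-- A continuous function is differentiable almost everywhere with derivative equal to its weak
derivative. -/
theorem HasWeakTimeDeriv.ae_hasDerivAt [CompleteSpace X] {T : ℝ} {v w : ℝ → X}
    (h : HasWeakTimeDeriv T v w) (hv : ContinuousOn v (Ioo 0 T)) :
    ∀ᵐ t ∂(volume.restrict (Ioo 0 T)), HasDerivAt v (w t) t := by
  -- Local integrability only allows Lebesgue differentiation on compact subintervals; rational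
  -- endpoints keep the union of exceptional sets null.
  have key : ∀ a b : ℚ, ∀ᵐ t : ℝ, 0 < (a : ℝ) → (b : ℝ) < T → t ∈ Ioo (a : ℝ) b →
      HasDerivAt v (w t) t := by
    intro a b
    by_cases hab : (0 : ℝ) < a ∧ (a : ℝ) ≤ b ∧ (b : ℝ) < T
    · obtain ⟨ha, hab, hb⟩ := hab
      have hwi : IntervalIntegrable w volume a b := by
        rw [intervalIntegrable_iff_integrableOn_Icc_of_le hab]
        exact h.2.1.integrableOn_compact_subset
          (fun x hx => ⟨ha.trans_le hx.1, hx.2.trans_lt hb⟩) isCompact_Icc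
      filter_upwards [hwi.ae_hasDerivAt_integral] with t ht _ _ htab
      rw [uIcc_of_le hab] at ht
      have hd := (ht (Ioo_subset_Icc_self htab) a ⟨le_rfl, hab⟩).const_add (v a)
      refine hd.congr_of_eventuallyEq ?_
      filter_upwards [Ioo_mem_nhds htab.1 htab.2] with s hs
      rw [← h.sub_eq_integral hv ha hs.1.le (hs.2.trans hb), add_sub_cancel]
    · refine .of_forall fun t ha hb ht => ?_
      exact absurd ⟨ha, (ht.1.trans ht.2).le, hb⟩ hab
  rw [ae_restrict_iff' measurableSet_Ioo]
  filter_upwards [ae_all_iff.2 fun a => ae_all_iff.2 (key a)] with t ht htT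
  obtain ⟨a, ha0, hat⟩ := exists_rat_btwn htT.1
  obtain ⟨b, hbt, hbT⟩ := exists_rat_btwn htT.2
  exact ht a b ha0 hbT ⟨hat, hbt⟩

end WeakTimeDerivative

/-! ### Grönwall's inequality. -/

/-- The **Grönwall inequality**, integral form with vanishing initial value. -/
theorem eq_zero_of_le_mul_integral {g : ℝ → ℝ} {C T : ℝ} (hT : 0 ≤ T)
    (hg : ContinuousOn g (Icc 0 T)) (hg0 : ∀ t ∈ Icc 0 T, 0 ≤ g t)
    (hle : ∀ t ∈ Ico 0 T, g t ≤ C * ∫ s in (0 : ℝ)..t, g s) :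
    ∀ t ∈ Ico 0 T, g t = 0 := by
  let G : ℝ → ℝ := IccExtend hT ((Icc 0 T).domRestrict g)
  have hG : Continuous G := hg.domRestrict.Icc_extend'
  have hGg : ∀ t ∈ Icc 0 T, G t = g t := fun t ht => by
    simp only [G, IccExtend_of_mem hT _ ht, domRestrict_apply]
  have hG0 : ∀ t, 0 ≤ G t := fun t => hg0 _ (projIcc 0 T hT t).2
  have hGle : ∀ t ∈ Ico 0 T, G t ≤ C * ∫ s in (0 : ℝ)..t, G s := by
    intro t ht
    rw [hGg t (Ico_subset_Icc_self ht)]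
    refine (hle t ht).trans_eq ?_
    congr 1
    refine intervalIntegral.integral_congr fun s hs => ?_
    rw [uIcc_of_le ht.1] at hs
    exact (hGg s ⟨hs.1, hs.2.trans ht.2.le⟩).symm
  have hd : ∀ t, HasDerivAt (fun t => ∫ s in (0 : ℝ)..t, G s) (G t) t := fun t =>
    intervalIntegral.integral_hasDerivAt_right (hG.intervalIntegrable _ _)
      (hG.stronglyMeasurableAtFilter _ _) hG.continuousAt
  -- The primitive of `G` has derivative bounded by `C` times itself and starts at zero.
  have hz := eq_zero_of_abs_deriv_le_mul_abs_self_of_eq_zero_right (K := C) (a := 0) (b := T)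
    (f := fun t => ∫ s in (0 : ℝ)..t, G s) (f' := G)
    (fun t _ => (hd t).continuousAt.continuousWithinAt)
    (fun t _ => (hd t).hasDerivWithinAt) intervalIntegral.integral_same
    (fun t ht => by
      rw [Real.norm_of_nonneg (hG0 t), Real.norm_of_nonneg
        (intervalIntegral.integral_nonneg ht.1 fun s _ => hG0 s)]
      exact hGle t ht)
  intro t ht
  have h1 := hGle t ht
  have h2 : ∫ s in (0 : ℝ)..t, G s = 0 := hz t (Ico_subset_Icc_self ht)
  rw [h2, mul_zero, hGg t (Ico_subset_Icc_self ht)] at h1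
  exact le_antisymm h1 (hg0 t (Ico_subset_Icc_self ht))

/-! ### Multiplication by bounded coefficients and the Lipschitz nonlinearity. -/

section Coefficients

variable {d : ℕ} {Ω : Set (E d)}

/-- Multiplication `L^∞(Ω) × L²(Ω) → L²(Ω)` as a continuous bilinear map. -/
noncomputable def mulL (Ω : Set (E d)) : Linf Ω →L[ℝ] L2 Ω →L[ℝ] L2 Ω :=
  (ContinuousLinearMap.lsmul ℝ ℝ).holderL (volOn Ω) ∞ 2 2

theorem lpSMul_sub {Y : Type*} [NormedAddCommGroup Y] [InnerProductSpace ℝ Y]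
    (a : Linf Ω) (v w : Lp Y 2 (volOn Ω)) :
    (a • (v - w) : Lp Y 2 (volOn Ω)) = (a • v : Lp Y 2 (volOn Ω)) - (a • w : Lp Y 2 (volOn Ω)) := by
  rw [sub_eq_add_neg, Lp.add_smul, Lp.smul_neg, ← sub_eq_add_neg]

/-- A coefficient bounded below by `c` gives a form that is coercive with constant `c`. -/
theorem mul_norm_sq_le_inner_smul {Y : Type*} [NormedAddCommGroup Y] [InnerProductSpace ℝ Y]
    {a : Linf Ω} {c : ℝ} (ha : ∀ᵐ x ∂(volOn Ω), c ≤ a x) (v : Lp Y 2 (volOn Ω)) :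
    c * ‖v‖ ^ 2 ≤ ⟪(a • v : Lp Y 2 (volOn Ω)), v⟫_ℝ := by
  rw [← real_inner_self_eq_norm_sq, ← real_inner_smul_left, L2.inner_def, L2.inner_def]
  refine integral_mono_ae (L2.integrable_inner _ _) (L2.integrable_inner _ _) ?_
  filter_upwards [ha, Lp.coeFn_lpSMul (r := 2) a v, Lp.coeFn_smul c v] with x hx h1 h2
  rw [h1, h2, Pi.smul_apply, Pi.smul_apply', real_inner_smul_left, real_inner_smul_left]
  exact mul_le_mul_of_nonneg_right hx real_inner_self_nonneg

theorem abs_inner_smul_le {Y : Type*} [NormedAddCommGroup Y] [InnerProductSpace ℝ Y]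
    (a : Linf Ω) (v w : Lp Y 2 (volOn Ω)) :
    |⟪(a • v : Lp Y 2 (volOn Ω)), w⟫_ℝ| ≤ ‖a‖ * ‖v‖ * ‖w‖ :=
  (abs_real_inner_le_norm _ _).trans (by gcongr; exact Lp.norm_smul_le _ _)

/-- Superposition with a Lipschitz function is Lipschitz on `L²` of a bounded set. -/
theorem abs_integral_comp_mul_sub_le (hΩb : Bornology.IsBounded Ω) {f : ℝ → ℝ} {Lf : ℝ≥0}
    (hf : LipschitzWith Lf f) (v w φ : L2 Ω) :
    |(∫ x in Ω, f (v x) * φ x) - ∫ x in Ω, f (w x) * φ x| ≤ Lf * ‖v - w‖ * ‖φ‖ := by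
  have : IsFiniteMeasure (volOn Ω) := ⟨by simpa using hΩb.measure_lt_top⟩
  have hm : ∀ p : L2 Ω, MemLp (fun x => f (p x)) 2 (volOn Ω) := by
    intro p
    -- Subtracting `f 0` makes the function vanish at 0, so that it preserves L²; the constant is in
    -- L² because Ω has finite measure.
    have h0 : LipschitzWith Lf (fun y => f y - f 0) := by
      refine LipschitzWith.of_dist_le_mul fun y z => ?_
      rw [dist_sub_right]
      exact hf.dist_le_mul y z
    have h1 : MemLp ((fun y => f y - f 0) ∘ p) 2 (volOn Ω) :=
      h0.comp_memLp (sub_self _) (Lp.memLp p)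
    refine (h1.add (memLp_const (f 0))).ae_eq (.of_forall fun x => ?_)
    exact sub_add_cancel (f (p x)) (f 0)
  have hi : ∀ p : L2 Ω, ∫ x in Ω, f (p x) * φ x = ⟪φ, (hm p).toLp⟫_ℝ := by
    intro p
    rw [L2.inner_def]
    refine integral_congr_ae ?_
    filter_upwards [(hm p).coeFn_toLp] with x hx
    rw [hx]; simp
  rw [hi, hi, ← inner_sub_right]
  refine (abs_real_inner_le_norm _ _).trans ?_
  rw [mul_comm]
  gcongr
  refine Lp.norm_le_mul_norm_of_ae_le_mul ?_
  filter_upwards [Lp.coeFn_sub (hm v).toLp (hm w).toLp, Lp.coeFn_sub v w, (hm v).coeFn_toLp,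
    (hm w).coeFn_toLp] with x h1 h2 h3 h4
  rw [h1, h2, Pi.sub_apply, Pi.sub_apply, h3, h4]
  exact hf.norm_sub_le _ _

end Coefficients

/-! ### Norm and completeness of H¹₀(Ω). -/

namespace H10

variable {d : ℕ} {Ω : Set (E d)}

/-- The embedding of `H¹₀(Ω)` into `L²(Ω)` as a continuous linear map. -/
noncomputable def fnL (Ω : Set (E d)) : H10 Ω →L[ℝ] L2 Ω :=
  (WithLp.fstL 2 ℝ (L2 Ω) (L2vec Ω)).comp (H10 Ω).subtypeL

theorem fn_sub (v w : H10 Ω) : fn (v - w) = fn v - fn w := rfl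

theorem norm_sq_eq (v : H10 Ω) : ‖v‖ ^ 2 = ‖fn v‖ ^ 2 + ‖grad v‖ ^ 2 :=
  WithLp.prod_norm_sq_eq_of_L2 (v : GraphSpace Ω)

theorem norm_fn_le (v : H10 Ω) : ‖fn v‖ ≤ ‖v‖ :=
  le_of_sq_le_sq (by rw [norm_sq_eq]; linarith [sq_nonneg ‖grad v‖]) (norm_nonneg v)

theorem norm_grad_le (v : H10 Ω) : ‖grad v‖ ≤ ‖v‖ :=
  le_of_sq_le_sq (by rw [norm_sq_eq]; linarith [sq_nonneg ‖fn v‖]) (norm_nonneg v)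

instance : CompleteSpace (H10 Ω) :=
  (Submodule.isClosed_topologicalClosure _).completeSpace_coe

end H10

/-! ### Product rule, energy estimate and vanishing of the difference. -/

section Uniqueness

variable {d : ℕ} {Ω : Set (E d)}

/-- The weak derivative of `ρu` is given by the product rule. -/
theorem ae_weakTimeDeriv_mul_eq {T : ℝ} {ρ : ℝ → Linf Ω} (hρ : ContDiffOn ℝ 1 ρ (Icc 0 T))
    {u u' : ℝ → H10 Ω} {z : ℝ → L2 Ω} (hu : ContinuousOn u (Icc 0 T))
    (hu' : HasWeakTimeDeriv T u u')
    (hz : HasWeakTimeDeriv T (fun t => (ρ t • H10.fn (u t) : L2 Ω)) z) :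
    ∀ᵐ t ∂(volume.restrict (Ioo 0 T)),
      z t = (ρ t • H10.fn (u' t) : L2 Ω)
        + (derivWithin ρ (Icc 0 T) t • H10.fn (u t) : L2 Ω) := by
  have hcont : ContinuousOn (fun t => (ρ t • H10.fn (u t) : L2 Ω)) (Ioo 0 T) := by
    have h1 : ContinuousOn (fun t => mulL Ω (ρ t) (H10.fnL Ω (u t))) (Icc 0 T) :=
      ((mulL Ω).continuous.comp_continuousOn hρ.continuousOn).clm_apply
        ((H10.fnL Ω).continuous.comp_continuousOn hu)
    exact h1.mono Ioo_subset_Icc_self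
  filter_upwards [hu'.ae_hasDerivAt (hu.mono Ioo_subset_Icc_self), hz.ae_hasDerivAt hcont,
    ae_restrict_mem measurableSet_Ioo] with t hut hzt ht
  have hnhds : Icc 0 T ∈ nhds t := Icc_mem_nhds ht.1 ht.2
  have hρt : HasDerivAt ρ (derivWithin ρ (Icc 0 T) t) t :=
    ((hρ.differentiableOn (by simp) t (Ioo_subset_Icc_self ht)).hasDerivWithinAt).hasDerivAt hnhds
  have hfn : HasDerivAt (fun t => H10.fnL Ω (u t)) (H10.fnL Ω (u' t)) t :=
    (H10.fnL Ω).hasFDerivAt.comp_hasDerivAt t hut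
  -- At such `t` both sides are classical derivatives of ρu.
  exact hzt.unique ((mulL Ω).hasDerivAt_of_bilinear (fun _ => hρt) (fun _ => hfn))

/-- The energy estimate obtained by testing the equation for the difference `q` of two solutions
with its time derivative `p`. -/
theorem norm_le_of_energy_identity {a a' b c : Linf Ω} {a₀ b₀ R K L N : ℝ} {p q : H10 Ω}
    (ha₀ : 0 < a₀) (hb₀ : 0 < b₀) (ha : ∀ᵐ x ∂(volOn Ω), a₀ ≤ a x)
    (hb : ∀ᵐ x ∂(volOn Ω), b₀ ≤ b x) (hR : ‖a'‖ ≤ R) (hK : ‖c‖ ≤ K) (hL : 0 ≤ L)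
    (hN : |N| ≤ L * ‖H10.fn q‖ * ‖H10.fn p‖)
    (h : ⟪(a • H10.fn p : L2 Ω), H10.fn p⟫_ℝ + ⟪(a' • H10.fn q : L2 Ω), H10.fn p⟫_ℝ
      + ⟪(b • H10.grad p : L2vec Ω), H10.grad p⟫_ℝ
      + ⟪(c • H10.grad q : L2vec Ω), H10.grad p⟫_ℝ = N) :
    ‖p‖ ≤ (R + K + L) / min a₀ b₀ * ‖q‖ := by
  have hm : 0 < min a₀ b₀ := lt_min ha₀ hb₀
  have h1 := mul_norm_sq_le_inner_smul ha (H10.fn p)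
  have h2 := mul_norm_sq_le_inner_smul hb (H10.grad p)
  have h3 := (abs_inner_smul_le a' (H10.fn q) (H10.fn p)).trans
    (show _ ≤ R * ‖q‖ * ‖p‖ by
      have := (norm_nonneg a').trans hR
      gcongr
      exacts [H10.norm_fn_le q, H10.norm_fn_le p])
  have h4 := (abs_inner_smul_le c (H10.grad q) (H10.grad p)).trans
    (show _ ≤ K * ‖q‖ * ‖p‖ by
      have := (norm_nonneg c).trans hK
      gcongr
      exacts [H10.norm_grad_le q, H10.norm_grad_le p])
  have h5 := hN.trans
    (show _ ≤ L * ‖q‖ * ‖p‖ by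
      gcongr
      exacts [H10.norm_fn_le q, H10.norm_fn_le p])
  have h6 : min a₀ b₀ * ‖H10.fn p‖ ^ 2 ≤ a₀ * ‖H10.fn p‖ ^ 2 := by
    gcongr
    exact min_le_left _ _
  have h7 : min a₀ b₀ * ‖H10.grad p‖ ^ 2 ≤ b₀ * ‖H10.grad p‖ ^ 2 := by
    gcongr
    exact min_le_right _ _
  have h8 : min a₀ b₀ * ‖p‖ * ‖p‖ ≤ (R + K + L) * ‖q‖ * ‖p‖ := by
    have := H10.norm_sq_eq p
    calc min a₀ b₀ * ‖p‖ * ‖p‖ = min a₀ b₀ * ‖H10.fn p‖ ^ 2 + min a₀ b₀ * ‖H10.grad p‖ ^ 2 := by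
          rw [mul_assoc, ← sq, this, mul_add]
      _ ≤ R * ‖q‖ * ‖p‖ + K * ‖q‖ * ‖p‖ + L * ‖q‖ * ‖p‖ := by
          linarith [(abs_le.1 h3).1, (abs_le.1 h4).1, (abs_le.1 h5).2]
      _ = (R + K + L) * ‖q‖ * ‖p‖ := by ring
  rw [div_mul_eq_mul_div, le_div_iff₀ hm, mul_comm ‖p‖]
  rcases (norm_nonneg p).eq_or_lt with hp | hp
  · rw [← hp, mul_zero]
    have := (norm_nonneg a').trans hR
    have := (norm_nonneg c).trans hK
    positivity
  · exact le_of_mul_le_mul_right h8 hp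

/-- A function with vanishing initial value whose weak derivative it controls vanishes. -/
theorem eq_zero_of_norm_weakTimeDeriv_le {X : Type*} [NormedAddCommGroup X] [NormedSpace ℝ X]
    [CompleteSpace X] {T C : ℝ} (hT : 0 < T) {q p : ℝ → X}
    (hq : ContinuousOn q (Icc 0 T)) (hq0 : q 0 = 0) (hp : HasWeakTimeDeriv T q p)
    (hC : 0 ≤ C) (hle : ∀ᵐ t ∂(volume.restrict (Ioo 0 T)), ‖p t‖ ≤ C * ‖q t‖) :
    ∀ t ∈ Icc 0 T, q t = 0 := by
  have hqo : ContinuousOn q (Ioo 0 T) := hq.mono Ioo_subset_Icc_self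
  have hqi : ∀ t ∈ Icc 0 T, ∀ s ∈ Icc 0 T, IntervalIntegrable (fun s => ‖q s‖) volume t s :=
    fun t ht s hs => (hq.norm.mono (ordConnected_Icc.uIcc_subset ht hs)).intervalIntegrable
  have h0T : (0 : ℝ) ∈ Icc 0 T := ⟨le_rfl, hT.le⟩
  -- The primitive formula holds only inside (0, T), so start at `a > 0` and let `a` tend to 0
  -- afterwards.
  have hstep : ∀ a t, 0 < a → a ≤ t → t < T →
      ‖q t - q a‖ ≤ C * ∫ s in (0 : ℝ)..t, ‖q s‖ := by
    intro a t ha hat ht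
    have haT : a ∈ Icc 0 T := ⟨ha.le, hat.trans ht.le⟩
    have htT : t ∈ Icc 0 T := ⟨ha.le.trans hat, ht.le⟩
    rw [hp.sub_eq_integral hqo ha hat ht]
    calc ‖∫ s in a..t, p s‖ ≤ ∫ s in a..t, C * ‖q s‖ := by
          refine intervalIntegral.norm_integral_le_of_norm_le hat ?_
            ((hqi a haT t htT).const_mul C)
          filter_upwards [(ae_restrict_iff' measurableSet_Ioo).1 hle] with s hs hsat
          exact hs ⟨ha.trans hsat.1, hsat.2.trans_lt ht⟩
      _ = C * ∫ s in a..t, ‖q s‖ := intervalIntegral.integral_const_mul _ _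
      _ ≤ C * ∫ s in (0 : ℝ)..t, ‖q s‖ := by
          gcongr
          rw [← intervalIntegral.integral_add_adjacent_intervals (hqi 0 h0T a haT)
            (hqi a haT t htT)]
          exact le_add_of_nonneg_left
            (intervalIntegral.integral_nonneg ha.le fun s _ => norm_nonneg _)
  have hgr : ∀ t ∈ Ico 0 T, ‖q t‖ ≤ C * ∫ s in (0 : ℝ)..t, ‖q s‖ := by
    intro t ht
    rcases ht.1.eq_or_lt with h0 | h0
    · rw [← h0, hq0]; simp
    · have hlim : Tendsto (fun a => ‖q t - q a‖) (nhdsWithin 0 (Ioo 0 t)) (nhds ‖q t‖) := by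
        have h1 : Tendsto q (nhdsWithin 0 (Ioo 0 t)) (nhds (q 0)) :=
          (hq 0 h0T).mono_left (nhdsWithin_mono _ fun s hs => ⟨hs.1.le, (hs.2.trans ht.2).le⟩)
        simpa [hq0] using (h1.const_sub (q t)).norm
      have : (nhdsWithin (0 : ℝ) (Ioo 0 t)).NeBot := by
        rw [← mem_closure_iff_nhdsWithin_neBot, closure_Ioo h0.ne]
        exact ⟨le_rfl, h0.le⟩
      refine le_of_tendsto hlim ?_
      filter_upwards [self_mem_nhdsWithin] with a ha
      exact hstep a t ha.1 ha.2.le ht.2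
  have hz : EqOn q (fun _ => 0) (Ico 0 T) := fun t ht => norm_eq_zero.1
    (eq_zero_of_le_mul_integral hT.le hq.norm (fun _ _ => norm_nonneg _) hgr t ht)
  -- The endpoint T follows by continuity.
  exact hz.of_subset_closure hq continuousOn_const Ico_subset_Icc_self
    (closure_Ico hT.ne).ge

theorem HasWeakTimeDeriv.sub {X : Type*} [NormedAddCommGroup X] [NormedSpace ℝ X] {T : ℝ}
    {u₁ u₂ w₁ w₂ : ℝ → X} (h₁ : HasWeakTimeDeriv T u₁ w₁) (h₂ : HasWeakTimeDeriv T u₂ w₂) :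
    HasWeakTimeDeriv T (fun t => u₁ t - u₂ t) (fun t => w₁ t - w₂ t) := by
  refine ⟨h₁.1.sub h₂.1, h₁.2.1.sub h₂.2.1, fun ψ hψ hc hs => ?_⟩
  -- The functions are only locally integrable on (0, T); compact support of `ψ` makes the products
  -- integrable, so the integrals split.
  have hi : ∀ {g : ℝ → ℝ} {v : ℝ → X}, LocallyIntegrableOn v (Ioo 0 T) → Continuous g →
      tsupport g ⊆ tsupport ψ → IntegrableOn (fun t => g t • v t) (Ioo 0 T) := by
    intro g v hv hg hsg
    have hK : IntegrableOn (fun t => g t • v t) (tsupport ψ) :=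
      (hv.integrableOn_compact_subset hs hc).continuousOn_smul hg.continuousOn hc
    exact (hK.integrable_of_forall_notMem_eq_zero fun t ht => by
      rw [image_eq_zero_of_notMem_tsupport (fun h => ht (hsg h)), zero_smul]).integrableOn
  have hd : Continuous (deriv ψ) := hψ.continuous_deriv (by simp)
  simp only [smul_sub]
  rw [integral_sub (hi h₁.1 hd tsupport_deriv_subset) (hi h₂.1 hd tsupport_deriv_subset),
    integral_sub (hi h₁.2.1 hψ.continuous subset_rfl) (hi h₂.2.1 hψ.continuous subset_rfl),
    h₁.2.2 ψ hψ hc hs, h₂.2.2 ψ hψ hc hs]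
  abel

end Uniqueness

end PseudoParabolic

/-! ### The uniqueness theorem. -/

open PseudoParabolic
theorem mainTheorem4 {d : ℕ} (Ω : Set (E d)) (hΩ : IsOpen Ω) (hΩb : Bornology.IsBounded Ω)
    (T : ℝ) (hT : 0 < T)
    (ρ η κ : ℝ → Linf Ω) (ρ₀ ρ₁ ρ₁' η₀ η₁ κ₀ κ₁ κ₁' : ℝ)
    (hρ : ContDiffOn ℝ 1 ρ (Icc 0 T)) (hρ₀ : 0 < ρ₀)
    (hρb : ∀ t ∈ Icc 0 T, ∀ᵐ x ∂(volOn Ω), ρ₀ ≤ ρ t x ∧ ρ t x ≤ ρ₁)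
    (hρ' : ∀ t ∈ Icc 0 T, ∀ᵐ x ∂(volOn Ω), |derivWithin ρ (Icc 0 T) t x| ≤ ρ₁')
    (hη : ContinuousOn η (Icc 0 T)) (hη₀ : 0 < η₀)
    (hηb : ∀ t ∈ Icc 0 T, ∀ᵐ x ∂(volOn Ω), η₀ ≤ η t x ∧ η t x ≤ η₁)
    (hκ : ContDiffOn ℝ 1 κ (Icc 0 T)) (hκ₀ : 0 < κ₀)
    (hκb : ∀ t ∈ Icc 0 T, ∀ᵐ x ∂(volOn Ω), κ₀ ≤ κ t x ∧ κ t x ≤ κ₁)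
    (hκ' : ∀ t ∈ Icc 0 T, ∀ᵐ x ∂(volOn Ω), |derivWithin κ (Icc 0 T) t x| ≤ κ₁')
    (f : ℝ → ℝ) (Lf : ℝ≥0) (hf : LipschitzWith Lf f)
    (F : ℝ → L2 Ω) (hF : MemLp F 2 (volume.restrict (Ioo 0 T)))
    (u₀ : H10 Ω) (u₁ u₂ : ℝ → H10 Ω)
    (hu₁ : IsSolution Ω T ρ η κ f F u₀ u₁) (hu₂ : IsSolution Ω T ρ η κ f F u₀ u₂) :
    ∀ t ∈ Icc 0 T, u₁ t = u₂ t := by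
  obtain ⟨hc₁, hi₁, v₁, hv₁, -, z₁, hz₁, he₁⟩ := hu₁
  obtain ⟨hc₂, hi₂, v₂, hv₂, -, z₂, hz₂, he₂⟩ := hu₂
  obtain ⟨R, hR⟩ := isCompact_Icc.exists_bound_of_continuousOn
    (hρ.continuousOn_derivWithin (uniqueDiffOn_Icc hT) le_rfl)
  obtain ⟨K, hK⟩ := isCompact_Icc.exists_bound_of_continuousOn hκ.continuousOn
  have h0T : (0 : ℝ) ∈ Icc 0 T := ⟨le_rfl, hT.le⟩
  have hR0 : 0 ≤ R := (norm_nonneg _).trans (hR 0 h0T)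
  have hK0 : 0 ≤ K := (norm_nonneg _).trans (hK 0 h0T)
  -- The initial condition compares functions only; injectivity of `H10.fn` upgrades it to equality
  -- in H¹₀, gradients included.
  have hinit : u₁ 0 - u₂ 0 = 0 :=
    sub_eq_zero.2 (H10.fn_injective hΩ (Lp.ext (hi₁.trans hi₂.symm)))
  have hest : ∀ᵐ t ∂(volume.restrict (Ioo 0 T)),
      ‖v₁ t - v₂ t‖ ≤ (R + K + Lf) / min ρ₀ η₀ * ‖u₁ t - u₂ t‖ := by
    filter_upwards [he₁, he₂, ae_weakTimeDeriv_mul_eq hρ hc₁ hv₁ hz₁,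
      ae_weakTimeDeriv_mul_eq hρ hc₂ hv₂ hz₂, ae_restrict_mem measurableSet_Ioo]
      with t h₁ h₂ hz₁t hz₂t ht'
    have ht : t ∈ Icc 0 T := Ioo_subset_Icc_self ht'
    refine norm_le_of_energy_identity (a := ρ t) (a' := derivWithin ρ (Icc 0 T) t) (b := η t)
      (c := κ t) hρ₀ hη₀ ((hρb t ht).mono fun x hx => hx.1) ((hηb t ht).mono fun x hx => hx.1)
      (hR t ht) (hK t ht) Lf.coe_nonneg
      (by rw [H10.fn_sub]; exact abs_integral_comp_mul_sub_le hΩb hf (H10.fn (u₁ t))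
            (H10.fn (u₂ t)) (H10.fn (v₁ t - v₂ t))) ?_
    -- The difference of the time derivatives serves as test function in both equations.
    have e₁ := h₁ (v₁ t - v₂ t)
    have e₂ := h₂ (v₁ t - v₂ t)
    rw [hz₁t, inner_add_left] at e₁
    rw [hz₂t, inner_add_left] at e₂
    have s₁ : (ρ t • H10.fn (v₁ t - v₂ t) : L2 Ω) = ρ t • H10.fn (v₁ t) - ρ t • H10.fn (v₂ t) :=
      lpSMul_sub _ _ _
    have s₂ : (derivWithin ρ (Icc 0 T) t • H10.fn (u₁ t - u₂ t) : L2 Ω)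
        = derivWithin ρ (Icc 0 T) t • H10.fn (u₁ t) - derivWithin ρ (Icc 0 T) t • H10.fn (u₂ t) :=
      lpSMul_sub _ _ _
    have s₃ : (η t • H10.grad (v₁ t - v₂ t) : L2vec Ω)
        = η t • H10.grad (v₁ t) - η t • H10.grad (v₂ t) := lpSMul_sub _ _ _
    have s₄ : (κ t • H10.grad (u₁ t - u₂ t) : L2vec Ω)
        = κ t • H10.grad (u₁ t) - κ t • H10.grad (u₂ t) := lpSMul_sub _ _ _
    rw [s₁, s₂, s₃, s₄, inner_sub_left, inner_sub_left, inner_sub_left, inner_sub_left]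
    linarith
  intro t ht
  refine sub_eq_zero.1 (eq_zero_of_norm_weakTimeDeriv_le hT (hc₁.sub hc₂) hinit (hv₁.sub hv₂)
    (div_nonneg (by positivity) (lt_min hρ₀ hη₀).le) hest t ht)
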